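/- Let $f:\mathbb R^m\times\mathbb R^n\to\mathbb R$ be twice continuously differentiable, with partial gradients $\nabla_1 f,\nabla_2 f$ and Jacobian blocks $\nabla_{11}f,\nabla_{12}f,\nabla_{21}f,\nabla_{22}f$, and let $L_1,L_2,\mu>0$. Assume that $f$ is $L_1$-smooth (its full gradient is $L_1$-Lipschitz), that $f(x,\cdot)$ is $\mu$-strongly concave for every $x$, that the four Jacobian blocks are $L_2$-Lipschitz in operator norm, and that $\Phi(x):=\max_{y\in\mathbb R^n}f(x,y)$ is bounded below and has compact sub-level sets. Put $\kappa=L_1/\mu$, $L_G=L_2(1+\kappa)^2$, $L_\Phi=L_2(1+\kappa)^3$, $y^*(x)=\arg\max_y f(x,y)$ and $G=\nabla_{11}f-\nabla_{12}f(\nabla_{22}f)^{-1}\nabla_{21}f$. Cubic-GDA with step sizes $\eta_x,\eta_y$, threshold $\epsilon'>0$ and inner iteration numbers $N_t\in\mathbb N$ starts from $x_0,y_0$ and, for $t=0,\dots,T-1$, obtains $y_{t+1}$ from $y_t$ by $N_t$ gradient ascent steps $\tilde y\mapsto\tilde y+\eta_y\nabla_2 f(x_t,\tilde y)$, takes $$s_{t+1}\in\arg\min_s\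 \nabla_1 f(x_t,y_{t+1})^\top s+\tfrac12 s^\top G(x_t,y_{t+1})s+\tfrac1{6\eta_x}\|s\|^3,$$ and sets $x_{t+1}=x_t+s_{t+1}$. By convention $\|s_0\|:=\epsilon'$. Let $T'=\min\{t\ge1:\max(\|s_{t-1}\|,\|s_t\|)\le\epsilon'\}$ be the termination time ($T'=\infty$ if there is no such $t$). Let $\alpha,\beta>0$, $0<\epsilon'\le\frac{\alpha L_1}{\beta L_G}$, $0<\eta_x\le(9L_\Phi+18\alpha+28\beta)^{-1}$, $\eta_y=\frac2{L_1+\mu}$, and suppose that $$N_0\ge\kappa\ln\frac{L_1\|y_0-y^*(x_0)\|}{2\beta\epsilon'^2},\qquad N_t\ge\kappa\ln\frac{2L_1\alpha\|s_{t-1}\|+L_1(\alpha+L_G\kappa)\|s_t\|}{L_G\beta\epsilon'^2}\quad(1\le t<T,\ t<T')$$ (the first condition is void if $y_0=y^*(x_0)$). Define $H_t:=\Phi(x_t)+(L_\Phi+2\alpha+3\beta)\|s_t\|^3$. Then $$H_{t+1}-H_t\le-(L_\Phi+\alpha+\beta)\big(\|s_{t+1}\|^3+\|s_t\|^3\big)$$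 for every $0\le t<T$ with $t\le T'-2$, and also for $t=0$ whatever $T'$ is (if $T\ge 1$). -/

import Mathlib

noncomputable section

namespace CubicGDA

variable {m n : ℕ}

/-- Partial gradient `∇₁ f (x, y)` in the first argument. -/
def gradX (f : EuclideanSpace ℝ (Fin m) → EuclideanSpace ℝ (Fin n) → ℝ)
    (x : EuclideanSpace ℝ (Fin m)) (y : EuclideanSpace ℝ (Fin n)) : EuclideanSpace ℝ (Fin m) :=
  gradient (fun x' => f x' y) x

/-- Partial gradient `∇₂ f (x, y)` in the second argument. -/
def gradY (f : EuclideanSpace ℝ (Fin m) → EuclideanSpace ℝ (Fin n) → ℝ)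
    (x : EuclideanSpace ℝ (Fin m)) (y : EuclideanSpace ℝ (Fin n)) : EuclideanSpace ℝ (Fin n) :=
  gradient (fun y' => f x y') y

/-- The block `∇₁₁ f (x, y)`, an `m × m` Jacobian, as a linear operator. -/
def hessXX (f : EuclideanSpace ℝ (Fin m) → EuclideanSpace ℝ (Fin n) → ℝ)
    (x : EuclideanSpace ℝ (Fin m)) (y : EuclideanSpace ℝ (Fin n)) :
    EuclideanSpace ℝ (Fin m) →L[ℝ] EuclideanSpace ℝ (Fin m) :=
  fderiv ℝ (fun x' => gradX f x' y) x

/-- The block `∇₁₂ f (x, y)`, an `m × n` Jacobian, as a linear operator. -/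
def hessXY (f : EuclideanSpace ℝ (Fin m) → EuclideanSpace ℝ (Fin n) → ℝ)
    (x : EuclideanSpace ℝ (Fin m)) (y : EuclideanSpace ℝ (Fin n)) :
    EuclideanSpace ℝ (Fin n) →L[ℝ] EuclideanSpace ℝ (Fin m) :=
  fderiv ℝ (fun y' => gradX f x y') y

/-- The block `∇₂₁ f (x, y)`, an `n × m` Jacobian, as a linear operator. -/
def hessYX (f : EuclideanSpace ℝ (Fin m) → EuclideanSpace ℝ (Fin n) → ℝ)
    (x : EuclideanSpace ℝ (Fin m)) (y : EuclideanSpace ℝ (Fin n)) :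
    EuclideanSpace ℝ (Fin m) →L[ℝ] EuclideanSpace ℝ (Fin n) :=
  fderiv ℝ (fun x' => gradY f x' y) x

/-- The block `∇₂₂ f (x, y)`, an `n × n` Jacobian, as a linear operator. -/
def hessYY (f : EuclideanSpace ℝ (Fin m) → EuclideanSpace ℝ (Fin n) → ℝ)
    (x : EuclideanSpace ℝ (Fin m)) (y : EuclideanSpace ℝ (Fin n)) :
    EuclideanSpace ℝ (Fin n) →L[ℝ] EuclideanSpace ℝ (Fin n) :=
  fderiv ℝ (fun y' => gradY f x y') y

/-- `G = ∇₁₁ f - ∇₁₂ f (∇₂₂ f)⁻¹ ∇₂₁ f`. -/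
def schurG (f : EuclideanSpace ℝ (Fin m) → EuclideanSpace ℝ (Fin n) → ℝ)
    (x : EuclideanSpace ℝ (Fin m)) (y : EuclideanSpace ℝ (Fin n)) :
    EuclideanSpace ℝ (Fin m) →L[ℝ] EuclideanSpace ℝ (Fin m) :=
  hessXX f x y - (hessXY f x y).comp ((hessYY f x y).inverse.comp (hessYX f x y))

/-- The envelope function `Φ(x) = max_y f (x, y)`. -/
def envelope (f : EuclideanSpace ℝ (Fin m) → EuclideanSpace ℝ (Fin n) → ℝ)
    (x : EuclideanSpace ℝ (Fin m)) : ℝ :=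
  ⨆ y, f x y

/-- The maximizer `y*(x) = argmax_y f (x, y)`. -/
def yStar (f : EuclideanSpace ℝ (Fin m) → EuclideanSpace ℝ (Fin n) → ℝ)
    (x : EuclideanSpace ℝ (Fin m)) : EuclideanSpace ℝ (Fin n) :=
  Classical.epsilon fun y => IsMaxOn (f x) Set.univ y

/-- The Euclidean distance in `ℝᵐ × ℝⁿ` (the product type itself carries the sup distance). -/
def pairDist (x x' : EuclideanSpace ℝ (Fin m)) (y y' : EuclideanSpace ℝ (Fin n)) : ℝ :=
  Real.sqrt (‖x - x'‖ ^ 2 + ‖y - y'‖ ^ 2)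

/-- The standing assumptions on the minimax problem `min_x max_y f (x, y)`. -/
structure Assumptions (f : EuclideanSpace ℝ (Fin m) → EuclideanSpace ℝ (Fin n) → ℝ)
    (L₁ L₂ μ : ℝ) : Prop where
  /-- `f` is twice continuously differentiable, jointly in both arguments. -/
  contDiff : ContDiff ℝ 2
    (fun p : EuclideanSpace ℝ (Fin m) × EuclideanSpace ℝ (Fin n) => f p.1 p.2)
  /-- `f` is `L₁`-smooth: the full gradient `(∇₁ f, ∇₂ f)` is `L₁`-Lipschitz (Euclidean norms). -/
  smooth : ∀ x x' y y',
    Real.sqrt (‖gradX f x y - gradX f x' y'‖ ^ 2 + ‖gradY f x y - gradY f x' y'‖ ^ 2)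
      ≤ L₁ * pairDist x x' y y'
  /-- `f (x, ·)` is `μ`-strongly concave for every `x`. -/
  strongConcave : ∀ x, StrongConcaveOn Set.univ μ (f x)
  /-- The four Jacobian blocks are `L₂`-Lipschitz in operator norm. -/
  lipXX : ∀ x x' y y', ‖hessXX f x y - hessXX f x' y'‖ ≤ L₂ * pairDist x x' y y'
  lipXY : ∀ x x' y y', ‖hessXY f x y - hessXY f x' y'‖ ≤ L₂ * pairDist x x' y y'
  lipYX : ∀ x x' y y', ‖hessYX f x y - hessYX f x' y'‖ ≤ L₂ * pairDist x x' y y'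
  lipYY : ∀ x x' y y', ‖hessYY f x y - hessYY f x' y'‖ ≤ L₂ * pairDist x x' y y'
  /-- `Φ` is bounded below and has compact sub-level sets. -/
  bddBelow : BddBelow (Set.range (envelope f))
  compactSublevel : ∀ c : ℝ, IsCompact {x | envelope f x ≤ c}

/-- One step of gradient ascent on `f (x, ·)`. -/
def ascentStep (f : EuclideanSpace ℝ (Fin m) → EuclideanSpace ℝ (Fin n) → ℝ) (ηy : ℝ)
    (x : EuclideanSpace ℝ (Fin m)) (y : EuclideanSpace ℝ (Fin n)) : EuclideanSpace ℝ (Fin n) :=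
  y + ηy • gradY f x y

/-- The objective `s ↦ ∇₁ f(x,y)ᵀ s + ½ sᵀ G(x,y) s + ‖s‖³ / (6 ηx)` of the cubic sub-problem. -/
def cubicModel (f : EuclideanSpace ℝ (Fin m) → EuclideanSpace ℝ (Fin n) → ℝ) (ηx : ℝ)
    (x : EuclideanSpace ℝ (Fin m)) (y : EuclideanSpace ℝ (Fin n))
    (s : EuclideanSpace ℝ (Fin m)) : ℝ :=
  inner ℝ (gradX f x y) s + 1 / 2 * inner ℝ s (schurG f x y s) + 1 / (6 * ηx) * ‖s‖ ^ 3

/-- `(x, y, s)` is a run of `T` outer iterations of Cubic-GDA with step sizes `ηx`, `ηy` and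
`N t` inner gradient ascent steps in iteration `t`. The increments are `s 1, …, s T`; the vector
`s 0` is not used (see `incr`). -/
structure IsRun (f : EuclideanSpace ℝ (Fin m) → EuclideanSpace ℝ (Fin n) → ℝ) (ηx ηy : ℝ)
    (N : ℕ → ℕ) (T : ℕ) (x : ℕ → EuclideanSpace ℝ (Fin m)) (y : ℕ → EuclideanSpace ℝ (Fin n))
    (s : ℕ → EuclideanSpace ℝ (Fin m)) : Prop where
  ascent : ∀ t < T, y (t + 1) = (ascentStep f ηy (x t))^[N t] (y t)
  cubic : ∀ t < T, IsMinOn (cubicModel f ηx (x t) (y (t + 1))) Set.univ (s (t + 1))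
  update : ∀ t < T, x (t + 1) = x t + s (t + 1)

/-- The number `‖s_t‖`, with the convention `‖s_0‖ = ε'`. -/
def incr (ε' : ℝ) (s : ℕ → EuclideanSpace ℝ (Fin m)) : ℕ → ℝ
  | 0 => ε'
  | t + 1 => ‖s (t + 1)‖

/-- The termination time `T' = min {t ≥ 1 : max ‖s_{t-1}‖ ‖s_t‖ ≤ ε'}` (`⊤` if there is none). -/
def stopTime (ε' : ℝ) (s : ℕ → EuclideanSpace ℝ (Fin m)) : ℕ∞ :=
  sInf {k : ℕ∞ | ∃ t : ℕ, k = t ∧ 1 ≤ t ∧ max (incr ε' s (t - 1)) (incr ε' s t) ≤ ε'}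

/-- `L_G = L₂ (1 + κ)²` with `κ = L₁ / μ`. -/
def constLG (L₁ L₂ μ : ℝ) : ℝ := L₂ * (1 + L₁ / μ) ^ 2

/-- `L_Φ = L₂ (1 + κ)³` with `κ = L₁ / μ`. -/
def constLPhi (L₁ L₂ μ : ℝ) : ℝ := L₂ * (1 + L₁ / μ) ^ 3

/-- The potential `H_t = Φ(x_t) + (L_Φ + 2α + 3β) ‖s_t‖³`. -/
def potential (f : EuclideanSpace ℝ (Fin m) → EuclideanSpace ℝ (Fin n) → ℝ)
    (L₁ L₂ μ α β ε' : ℝ) (x s : ℕ → EuclideanSpace ℝ (Fin m)) (t : ℕ) : ℝ :=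
  envelope f (x t) + (constLPhi L₁ L₂ μ + 2 * α + 3 * β) * incr ε' s t ^ 3

end CubicGDA

end

noncomputable section

namespace CubicGDA

open InnerProductSpace Filter Topology

/-! ### Calculus and operator estimates in inner product spaces. -/

section General

variable {E F : Type*} [NormedAddCommGroup E] [InnerProductSpace ℝ E] [CompleteSpace E]
  [NormedAddCommGroup F] [InnerProductSpace ℝ F]

/-! Cubic-GDA is an inexact cubic-regularized Newton method on the envelope `Φ`. Since `∇₂f(x,
y*(x)) = 0`, the gradient of `Φ` is `∇₁f(x, y*(x))` and its Hessian is `G(x, y*(x))`. This Hessian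
is `L_Φ`-Lipschitz, so `Φ` has a second-order Taylor bound with remainder `L_Φ‖s‖³/6`
(`envelope_add_le`). A minimizer `s` of the cubic model makes its linear and quadratic terms at most
`-‖s‖³/(4ηx)` (`cubic_min_value_le`). Evaluating the model at `y_{t+1}` instead of `y*(x_t)` costs
`L₁e‖s‖ + L_G e‖s‖²/2`, where `e = ‖y_{t+1} - y*(x_t)‖` (`envelope_cubic_step_le`).

With `a = ‖s_t‖` and `b = ‖s_{t+1}‖`, it suffices that `L₁e ≤ β(2a² + b²)` and `L_G e ≤ α(2a + b)`:
the errors are then cubic in `a`, `b`, and the step size together with the `‖s_t‖³` term of the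
potential absorbs them.

Gradient ascent contracts the distance to `y*` by `exp(-1/κ)` per step, and `y*` is `κ`-Lipschitz,
so the relative bound on `e` at one iteration controls the starting error of the next inner loop.
The prescribed `N_t` then gives `e ≤ βε'²/L₁`. Before termination one of two consecutive increments
exceeds `ε'`, which turns this absolute bound back into the relative one and closes an induction on
`t`. -/

theorem gradient_eq (g : E → ℝ) (a : E) : gradient g a = (toDual ℝ E).symm (fderiv ℝ g a) := rfl

theorem inner_gradient (g : E → ℝ) (a v : E) : inner ℝ (gradient g a) v = fderiv ℝ g a v := by
  rw [gradient_eq, toDual_symm_apply]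

/-- The bounded linear isometry underlying the inverse of the Riesz map, over `ℝ`. -/
def rieszInv (E : Type*) [NormedAddCommGroup E] [InnerProductSpace ℝ E] [CompleteSpace E] :
    StrongDual ℝ E →L[ℝ] E where
  toFun := (toDual ℝ E).symm
  map_add' := map_add _
  map_smul' r φ := by simp
  cont := (toDual ℝ E).symm.continuous

theorem gradient_eq_rieszInv (g : E → ℝ) (a : E) : gradient g a = rieszInv E (fderiv ℝ g a) := rfl

theorem inner_rieszInv (φ : StrongDual ℝ E) (v : E) : inner ℝ (rieszInv E φ) v = φ v :=
  toDual_symm_apply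

/-- The derivative of the gradient of a `C²` function is symmetric. -/
theorem inner_fderiv_gradient_comm {g : E → ℝ} (hg : ContDiff ℝ 2 g) (a v w : E) :
    inner ℝ (fderiv ℝ (gradient g) a v) w = inner ℝ (fderiv ℝ (gradient g) a w) v := by
  have hd : DifferentiableAt ℝ (fderiv ℝ g) a :=
    ((hg.fderiv_right (m := 1) (by norm_num)).differentiable one_ne_zero) a
  have h : fderiv ℝ (gradient g) a = (rieszInv E).comp (fderiv ℝ (fderiv ℝ g) a) := by
    have : HasFDerivAt (fun b => rieszInv E (fderiv ℝ g b))
        ((rieszInv E).comp (fderiv ℝ (fderiv ℝ g) a)) a :=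
      (rieszInv E).hasFDerivAt.comp a hd.hasFDerivAt
    exact this.fderiv
  rw [h]
  simp only [ContinuousLinearMap.comp_apply, inner_rieszInv]
  exact hg.contDiffAt.isSymmSndFDerivAt (by simp) v w

/-- First-order characterisation of strong concavity. -/
theorem strongConcaveOn_first_order {g : E → ℝ} {μ : ℝ} (hg : StrongConcaveOn Set.univ μ g)
    (hd : Differentiable ℝ g) (a b : E) :
    g b ≤ g a + inner ℝ (gradient g a) (b - a) - μ / 2 * ‖b - a‖ ^ 2 := by
  have hder : HasDerivAt (fun t : ℝ => g (a + t • (b - a))) (fderiv ℝ g a (b - a)) 0 := by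
    have h1 : HasDerivAt (fun t : ℝ => a + t • (b - a)) (b - a) 0 := by
      simpa using ((hasDerivAt_id (0 : ℝ)).smul_const (b - a)).const_add a
    have h2 : HasFDerivAt g (fderiv ℝ g a) (a + (0 : ℝ) • (b - a)) := by
      simpa using (hd a).hasFDerivAt
    exact h2.comp_hasDerivAt 0 h1
  have hslope := (hasDerivAt_iff_tendsto_slope_zero.1 hder)
  have hs : Tendsto (fun t : ℝ => t⁻¹ • (g (a + (0 + t) • (b - a)) - g (a + (0 : ℝ) • (b - a))))
      (𝓝[>] 0) (𝓝 (fderiv ℝ g a (b - a))) :=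
    hslope.mono_left (nhdsWithin_mono _ fun t ht => ne_of_gt ht)
  -- The concavity inequality at `(1 - t)a + tb`, divided by `t`, bounds the slope below by this
  -- function; the claim is its limit as `t → 0⁺`.
  have hl : Tendsto (fun t : ℝ => g b - g a + (1 - t) * (μ / 2 * ‖b - a‖ ^ 2)) (𝓝[>] 0)
      (𝓝 (g b - g a + (1 - 0) * (μ / 2 * ‖b - a‖ ^ 2))) := by
    refine Tendsto.mono_left ?_ nhdsWithin_le_nhds
    apply Continuous.tendsto
    fun_prop
  have hle := le_of_tendsto_of_tendsto hl hs (by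
    filter_upwards [Ioo_mem_nhdsGT (zero_lt_one : (0 : ℝ) < 1)] with t ht
    have h0 := hg.2
    have h := h0 (Set.mem_univ a) (Set.mem_univ b) (a := 1 - t) (b := t)
      (by linarith [ht.2]) ht.1.le (by ring)
    have he : (1 - t) • a + t • b = a + (0 + t) • (b - a) := by module
    rw [he] at h
    simp only [smul_eq_mul] at h ⊢
    rw [zero_smul, add_zero, inv_mul_eq_div, le_div_iff₀ ht.1, norm_sub_rev b a]
    nlinarith)
  rw [inner_gradient]
  linarith

theorem strongConcaveOn_gradient_monotone {g : E → ℝ} {μ : ℝ}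
    (hg : StrongConcaveOn Set.univ μ g) (hd : Differentiable ℝ g) (a b : E) :
    inner ℝ (gradient g a - gradient g b) (a - b) ≤ -μ * ‖a - b‖ ^ 2 := by
  have h1 := strongConcaveOn_first_order hg hd a b
  have h2 := strongConcaveOn_first_order hg hd b a
  rw [norm_sub_rev b a, ← neg_sub a b, inner_neg_right] at h1
  rw [inner_sub_left]
  linarith

/-- A differentiable strongly concave function on a finite-dimensional space has a maximizer. -/
theorem strongConcaveOn_exists_isMaxOn [FiniteDimensional ℝ E] {g : E → ℝ} {μ : ℝ} (hμ : 0 < μ)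
    (hg : StrongConcaveOn Set.univ μ g) (hd : Differentiable ℝ g) :
    ∃ a, IsMaxOn g Set.univ a := by
  -- The first-order bound at `0` majorizes `g` by this downward parabola in `‖b‖`, so `g` tends to
  -- `-∞` at infinity.
  have hq : Tendsto (fun r : ℝ => g 0 + (‖gradient g 0‖ * r - μ / 2 * r ^ 2)) atTop atBot := by
    apply tendsto_atBot_add_const_left
    have : (fun r : ℝ => ‖gradient g 0‖ * r - μ / 2 * r ^ 2)
        = fun r => r * (‖gradient g 0‖ + (-(μ / 2)) * r) := by ext r; ring
    rw [this]
    refine tendsto_id.atTop_mul_atBot₀ ?_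
    exact tendsto_atBot_add_const_left _ _ (tendsto_id.const_mul_atTop_of_neg (by linarith))
  have ht : Tendsto g (cocompact E) atBot := by
    refine tendsto_atBot_mono (fun b => ?_) (hq.comp (tendsto_norm_cocompact_atTop (E := E)))
    have h := strongConcaveOn_first_order hg hd 0 b
    have h' := real_inner_le_norm (gradient g 0) b
    simp only [sub_zero, Function.comp_apply] at h ⊢
    linarith
  obtain ⟨a, ha⟩ := hd.continuous.exists_forall_ge ht
  exact ⟨a, fun b _ => ha b⟩

/-- A symmetric operator whose quadratic form is bounded by `ρ ‖v‖²` has norm at most `ρ`. -/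
theorem opNorm_le_of_symmetric_of_quadratic {M : F →L[ℝ] F} {ρ : ℝ} (hρ : 0 ≤ ρ)
    (hsymm : ∀ v w, inner ℝ (M v) w = inner ℝ (M w) v)
    (hM : ∀ v, |inner ℝ (M v) v| ≤ ρ * ‖v‖ ^ 2) : ‖M‖ ≤ ρ := by
  refine M.opNorm_le_bound hρ fun u => ?_
  -- Polarization: `4⟪Mu, w⟫` is the difference of the quadratic form at `u + w` and `u - w`, and
  -- the parallelogram law sums the two bounds.
  have key : ∀ w : F, 2 * inner ℝ (M u) w ≤ ρ * (‖u‖ ^ 2 + ‖w‖ ^ 2) := by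
    intro w
    have h1 := (abs_le.1 (hM (u + w))).2
    have h2 := (abs_le.1 (hM (u - w))).1
    have h3 := parallelogram_law_with_norm ℝ u w
    simp only [map_add, map_sub, inner_add_left, inner_add_right, inner_sub_left,
      inner_sub_right] at h1 h2
    have h4 := hsymm u w
    nlinarith
  rcases eq_or_ne (M u) 0 with h0 | h0
  · rw [h0, norm_zero]; positivity
  have hpos : 0 < ‖M u‖ := norm_pos_iff.2 h0
  -- This multiple of `M u` has norm `‖u‖`, which balances the two squares.
  have h := key ((‖u‖ / ‖M u‖) • M u)
  rw [inner_smul_right, real_inner_self_eq_norm_sq, norm_smul, Real.norm_of_nonneg (by positivity),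
    div_mul_cancel₀ _ hpos.ne'] at h
  have h5 : ‖u‖ / ‖M u‖ * ‖M u‖ ^ 2 = ‖u‖ * ‖M u‖ := by field_simp
  rw [h5] at h
  rcases eq_or_ne u 0 with hu | hu
  · simp [hu]
  have hu' : 0 < ‖u‖ := norm_pos_iff.2 hu
  nlinarith

/-- Second-order Taylor bound on `[0, 1]` when `φ''` grows at most linearly. -/
theorem taylor_second_order_le {φ φ' φ'' : ℝ → ℝ} {K : ℝ}
    (h1 : ∀ t, HasDerivAt φ (φ' t) t) (h2 : ∀ t, HasDerivAt φ' (φ'' t) t)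
    (hK : ∀ t, 0 ≤ t → φ'' t ≤ φ'' 0 + K * t) :
    φ 1 ≤ φ 0 + φ' 0 + φ'' 0 / 2 + K / 6 := by
  have antitone_aux : ∀ g g' : ℝ → ℝ, (∀ t, HasDerivAt g (g' t) t) → (∀ t, 0 ≤ t → g' t ≤ 0) →
      ∀ t, 0 ≤ t → g t ≤ g 0 := by
    intro g g' hg hg' t ht
    refine antitoneOn_of_deriv_nonpos (convex_Ici (0 : ℝ))
      (fun t _ => (hg t).continuousAt.continuousWithinAt)
      (fun t _ => (hg t).differentiableAt.differentiableWithinAt) (fun t ht => ?_)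
      (Set.mem_Ici.2 le_rfl) (Set.mem_Ici.2 ht) ht
    rw [interior_Ici] at ht
    rw [(hg t).deriv]
    exact hg' t ht.le
  have hb : ∀ t, 0 ≤ t → φ' t ≤ φ' 0 + φ'' 0 * t + K / 2 * t ^ 2 := by
    intro t ht
    have := antitone_aux (fun t => φ' t - φ'' 0 * t - K / 2 * t ^ 2)
      (fun t => φ'' t - φ'' 0 * 1 - K / 2 * (2 * t))
      (fun t => by
        simpa using ((h2 t).fun_sub ((hasDerivAt_id t).const_mul (φ'' 0))).fun_sub
          ((hasDerivAt_pow 2 t).const_mul (K / 2)))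
      (fun t ht => by linarith [hK t ht]) t ht
    linarith
  have := antitone_aux (fun t => φ t - φ' 0 * t - φ'' 0 / 2 * t ^ 2 - K / 6 * t ^ 3)
      (fun t => φ' t - φ' 0 * 1 - φ'' 0 / 2 * (2 * t) - K / 6 * (3 * t ^ 2))
      (fun t => by
        simpa using (((h1 t).fun_sub ((hasDerivAt_id t).const_mul (φ' 0))).fun_sub
          ((hasDerivAt_pow 2 t).const_mul (φ'' 0 / 2))).fun_sub
          ((hasDerivAt_pow 3 t).const_mul (K / 6)))
      (fun t ht => by linarith [hb t ht]) 1 zero_le_one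
  linarith

/-- A minimizer `s` of a cubic-regularized quadratic has model value at most `-c ‖s‖³ / 2`. -/
theorem cubic_min_value_le {g s : F} {A : F →L[ℝ] F} {c : ℝ}
    (hs : IsMinOn (fun v => inner ℝ g v + 1 / 2 * inner ℝ v (A v) + c * ‖v‖ ^ 3) Set.univ s) :
    inner ℝ g s + 1 / 2 * inner ℝ s (A s) + c * ‖s‖ ^ 3 ≤ -(c * ‖s‖ ^ 3 / 2) := by
  set a := inner ℝ g s
  set b := inner ℝ s (A s)
  set d := c * ‖s‖ ^ 3
  -- Restriction to the line `ℝ s`, where the minimum is at `r = 1`. Comparison with `r = -1` gives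
  -- `a ≤ 0`, stationarity gives `a + b + 3d = 0`, and so the value is `a/2 - d/2`.
  have hval : ∀ r : ℝ, a + 1 / 2 * b + d ≤ a * r + b / 2 * r ^ 2 + d * |r| ^ 3 := by
    intro r
    have h := hs (Set.mem_univ (r • s))
    simp only [Set.mem_ofPred_eq, map_smul, inner_smul_left, inner_smul_right, norm_smul,
      Real.norm_eq_abs, conj_trivial, mul_pow] at h
    calc _ ≤ _ := h
      _ = _ := by simp only [a, b, d]; ring
  have ha : a ≤ 0 := by
    have := hval (-1)
    norm_num at this
    linarith
  have hcrit : a + b + 3 * d = 0 := by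
    have hd : HasDerivAt (fun r : ℝ => a * r + b / 2 * r ^ 2 + d * r ^ 3)
        (a * 1 + b / 2 * (2 * 1) + d * (3 * 1)) 1 := by
      simpa using (((hasDerivAt_id (1 : ℝ)).const_mul a).fun_add
        ((hasDerivAt_pow 2 (1 : ℝ)).const_mul (b / 2))).fun_add
        ((hasDerivAt_pow 3 (1 : ℝ)).const_mul d)
    have hmin : IsLocalMin (fun r : ℝ => a * r + b / 2 * r ^ 2 + d * r ^ 3) 1 := by
      filter_upwards [Ioi_mem_nhds (zero_lt_one : (0 : ℝ) < 1)] with r hr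
      have := hval r
      rw [abs_of_pos hr] at this
      linarith
    have hzero := hmin.hasDerivAt_eq_zero hd
    linarith
  linarith

end General

/-! ### Partial derivatives and regularity of the partial gradients. -/

section Blocks

variable {m n : ℕ} {f : EuclideanSpace ℝ (Fin m) → EuclideanSpace ℝ (Fin n) → ℝ}

section Partial

variable {E F G : Type*} [NormedAddCommGroup E] [NormedSpace ℝ E] [NormedAddCommGroup F]
  [NormedSpace ℝ F] [NormedAddCommGroup G] [NormedSpace ℝ G] {H : E × F → G} {x : E} {y : F}

theorem hasFDerivAt_partial_left {D : E × F →L[ℝ] G} (h : HasFDerivAt H D (x, y)) :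
    HasFDerivAt (fun x' => H (x', y)) (D.comp (.inl ℝ E F)) x :=
  h.comp x (hasFDerivAt_prodMk_left x y)

theorem hasFDerivAt_partial_right {D : E × F →L[ℝ] G} (h : HasFDerivAt H D (x, y)) :
    HasFDerivAt (fun y' => H (x, y')) (D.comp (.inr ℝ E F)) y :=
  h.comp y (hasFDerivAt_prodMk_right x y)

theorem hasFDerivAt_coprod_partial (h : DifferentiableAt ℝ H (x, y)) :
    HasFDerivAt H ((fderiv ℝ (fun x' => H (x', y)) x).coprod (fderiv ℝ (fun y' => H (x, y')) y))
      (x, y) := by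
  rw [(hasFDerivAt_partial_left h.hasFDerivAt).fderiv,
    (hasFDerivAt_partial_right h.hasFDerivAt).fderiv]
  convert h.hasFDerivAt using 1
  ext v <;> simp

theorem hasFDerivAt_comp_graph {k : E → F} {K : E →L[ℝ] F} {A : E →L[ℝ] G} {B : F →L[ℝ] G}
    (h : HasFDerivAt H (A.coprod B) (x, k x)) (hk : HasFDerivAt k K x) :
    HasFDerivAt (fun x' => H (x', k x')) (A + B.comp K) x := by
  refine HasFDerivAt.congr_fderiv (h.comp x ((hasFDerivAt_id x).prodMk hk)) ?_
  ext v
  simp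

end Partial

theorem contDiff_gradX
    (hc : ContDiff ℝ 2
      (fun p : EuclideanSpace ℝ (Fin m) × EuclideanSpace ℝ (Fin n) => f p.1 p.2)) :
    ContDiff ℝ 1 (fun p : EuclideanSpace ℝ (Fin m) × EuclideanSpace ℝ (Fin n) =>
      gradX f p.1 p.2) := by
  have h : (fun p : EuclideanSpace ℝ (Fin m) × EuclideanSpace ℝ (Fin n) => gradX f p.1 p.2)
      = fun p => rieszInv _ ((fderiv ℝ (fun p : EuclideanSpace ℝ (Fin m) ×
          EuclideanSpace ℝ (Fin n) => f p.1 p.2) p).comp (.inl ℝ _ _)) := by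
    ext1 ⟨x, y⟩
    have h1 := hasFDerivAt_partial_left (hc.differentiable two_ne_zero (x, y)).hasFDerivAt
    rw [gradX, gradient_eq_rieszInv]
    exact congrArg _ h1.fderiv
  rw [h]
  exact (rieszInv _).contDiff.comp
    ((hc.fderiv_right (m := 1) (by norm_num)).clm_comp contDiff_const)

theorem contDiff_gradY
    (hc : ContDiff ℝ 2
      (fun p : EuclideanSpace ℝ (Fin m) × EuclideanSpace ℝ (Fin n) => f p.1 p.2)) :
    ContDiff ℝ 1 (fun p : EuclideanSpace ℝ (Fin m) × EuclideanSpace ℝ (Fin n) =>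
      gradY f p.1 p.2) := by
  have h : (fun p : EuclideanSpace ℝ (Fin m) × EuclideanSpace ℝ (Fin n) => gradY f p.1 p.2)
      = fun p => rieszInv _ ((fderiv ℝ (fun p : EuclideanSpace ℝ (Fin m) ×
          EuclideanSpace ℝ (Fin n) => f p.1 p.2) p).comp (.inr ℝ _ _)) := by
    ext1 ⟨x, y⟩
    have h1 := hasFDerivAt_partial_right (hc.differentiable two_ne_zero (x, y)).hasFDerivAt
    rw [gradY, gradient_eq_rieszInv]
    exact congrArg _ h1.fderiv
  rw [h]
  exact (rieszInv _).contDiff.comp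
    ((hc.fderiv_right (m := 1) (by norm_num)).clm_comp contDiff_const)

end Blocks

/-! ### Bounds on the Jacobian blocks. -/

namespace Assumptions

variable {m n : ℕ} {f : EuclideanSpace ℝ (Fin m) → EuclideanSpace ℝ (Fin n) → ℝ} {L₁ L₂ μ : ℝ}

theorem hasFDerivAt_gradX (hf : Assumptions f L₁ L₂ μ) (x : EuclideanSpace ℝ (Fin m))
    (y : EuclideanSpace ℝ (Fin n)) :
    HasFDerivAt (fun p : EuclideanSpace ℝ (Fin m) × EuclideanSpace ℝ (Fin n) => gradX f p.1 p.2)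
      ((hessXX f x y).coprod (hessXY f x y)) (x, y) :=
  hasFDerivAt_coprod_partial ((contDiff_gradX hf.contDiff).differentiable one_ne_zero (x, y))

theorem hasFDerivAt_gradY (hf : Assumptions f L₁ L₂ μ) (x : EuclideanSpace ℝ (Fin m))
    (y : EuclideanSpace ℝ (Fin n)) :
    HasFDerivAt (fun p : EuclideanSpace ℝ (Fin m) × EuclideanSpace ℝ (Fin n) => gradY f p.1 p.2)
      ((hessYX f x y).coprod (hessYY f x y)) (x, y) :=
  hasFDerivAt_coprod_partial ((contDiff_gradY hf.contDiff).differentiable one_ne_zero (x, y))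

theorem contDiff_right (hf : Assumptions f L₁ L₂ μ) (x : EuclideanSpace ℝ (Fin m)) :
    ContDiff ℝ 2 (f x) :=
  hf.contDiff.comp (contDiff_const.prodMk contDiff_id)

theorem hasFDerivAt_gradY_right (hf : Assumptions f L₁ L₂ μ) (x : EuclideanSpace ℝ (Fin m))
    (y : EuclideanSpace ℝ (Fin n)) : HasFDerivAt (gradY f x) (hessYY f x y) y := by
  have := hasFDerivAt_partial_right (hf.hasFDerivAt_gradY x y)
  simpa using this

theorem hasFDerivAt_gradY_left (hf : Assumptions f L₁ L₂ μ) (x : EuclideanSpace ℝ (Fin m))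
    (y : EuclideanSpace ℝ (Fin n)) : HasFDerivAt (fun x' => gradY f x' y) (hessYX f x y) x := by
  have := hasFDerivAt_partial_left (hf.hasFDerivAt_gradY x y)
  simpa using this

theorem hasFDerivAt_gradX_right (hf : Assumptions f L₁ L₂ μ) (x : EuclideanSpace ℝ (Fin m))
    (y : EuclideanSpace ℝ (Fin n)) : HasFDerivAt (fun y' => gradX f x y') (hessXY f x y) y := by
  have := hasFDerivAt_partial_right (hf.hasFDerivAt_gradX x y)
  simpa using this

theorem norm_gradX_sub_le (hf : Assumptions f L₁ L₂ μ) (x : EuclideanSpace ℝ (Fin m))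
    (y y' : EuclideanSpace ℝ (Fin n)) : ‖gradX f x y - gradX f x y'‖ ≤ L₁ * ‖y - y'‖ := by
  refine le_trans (Real.le_sqrt_of_sq_le ?_) ((hf.smooth x x y y').trans_eq ?_)
  · exact le_add_of_nonneg_right (sq_nonneg _)
  · simp [pairDist]

theorem norm_gradY_sub_le_right (hf : Assumptions f L₁ L₂ μ) (x : EuclideanSpace ℝ (Fin m))
    (y y' : EuclideanSpace ℝ (Fin n)) : ‖gradY f x y - gradY f x y'‖ ≤ L₁ * ‖y - y'‖ := by
  refine le_trans (Real.le_sqrt_of_sq_le ?_) ((hf.smooth x x y y').trans_eq ?_)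
  · exact le_add_of_nonneg_left (sq_nonneg _)
  · simp [pairDist]

theorem norm_gradY_sub_le_left (hf : Assumptions f L₁ L₂ μ) (x x' : EuclideanSpace ℝ (Fin m))
    (y : EuclideanSpace ℝ (Fin n)) : ‖gradY f x y - gradY f x' y‖ ≤ L₁ * ‖x - x'‖ := by
  refine le_trans (Real.le_sqrt_of_sq_le ?_) ((hf.smooth x x' y y).trans_eq ?_)
  · exact le_add_of_nonneg_left (sq_nonneg _)
  · simp [pairDist]

theorem norm_hessXY_le (hf : Assumptions f L₁ L₂ μ) (hL₁ : 0 < L₁) (x : EuclideanSpace ℝ (Fin m))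
    (y : EuclideanSpace ℝ (Fin n)) : ‖hessXY f x y‖ ≤ L₁ :=
  (hf.hasFDerivAt_gradX_right x y).le_of_lip' hL₁.le
    (Eventually.of_forall fun z => hf.norm_gradX_sub_le x z y)

theorem norm_hessYX_le (hf : Assumptions f L₁ L₂ μ) (hL₁ : 0 < L₁) (x : EuclideanSpace ℝ (Fin m))
    (y : EuclideanSpace ℝ (Fin n)) : ‖hessYX f x y‖ ≤ L₁ :=
  (hf.hasFDerivAt_gradY_left x y).le_of_lip' hL₁.le
    (Eventually.of_forall fun z => hf.norm_gradY_sub_le_left z x y)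

theorem norm_hessYY_le (hf : Assumptions f L₁ L₂ μ) (hL₁ : 0 < L₁) (x : EuclideanSpace ℝ (Fin m))
    (y : EuclideanSpace ℝ (Fin n)) : ‖hessYY f x y‖ ≤ L₁ :=
  (hf.hasFDerivAt_gradY_right x y).le_of_lip' hL₁.le
    (Eventually.of_forall fun z => hf.norm_gradY_sub_le_right x z y)

theorem inner_gradY_sub_le (hf : Assumptions f L₁ L₂ μ) (x : EuclideanSpace ℝ (Fin m))
    (y y' : EuclideanSpace ℝ (Fin n)) :
    inner ℝ (gradY f x y - gradY f x y') (y - y') ≤ -μ * ‖y - y'‖ ^ 2 :=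
  strongConcaveOn_gradient_monotone (hf.strongConcave x)
    ((hf.contDiff_right x).differentiable two_ne_zero) y y'

theorem inner_hessYY_le (hf : Assumptions f L₁ L₂ μ) (x : EuclideanSpace ℝ (Fin m))
    (y v : EuclideanSpace ℝ (Fin n)) : inner ℝ (hessYY f x y v) v ≤ -μ * ‖v‖ ^ 2 := by
  have h1 : HasDerivAt (fun t : ℝ => y + t • v) v 0 := by
    simpa using ((hasDerivAt_id (0 : ℝ)).smul_const v).const_add y
  have h2 : HasFDerivAt (gradY f x) (hessYY f x y) (y + (0 : ℝ) • v) := by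
    simpa using hf.hasFDerivAt_gradY_right x y
  have hslope := hasDerivAt_iff_tendsto_slope_zero.1 (h2.comp_hasDerivAt 0 h1)
  have hs := Filter.Tendsto.inner (𝕜 := ℝ)
    (hslope.mono_left (nhdsWithin_mono _ fun t (ht : t ∈ Set.Ioi (0 : ℝ)) => ne_of_gt ht))
    (tendsto_const_nhds (x := v) (f := 𝓝[>] (0 : ℝ)))
  refine le_of_tendsto hs ?_
  filter_upwards [self_mem_nhdsWithin] with t (ht : 0 < t)
  have h := hf.inner_gradY_sub_le x (y + t • v) y
  simp only [add_sub_cancel_left, inner_smul_right, norm_smul, Real.norm_of_nonneg ht.le,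
    mul_pow] at h
  simp only [Function.comp_apply, zero_add, zero_smul, add_zero, inner_smul_left, conj_trivial]
  rw [inv_mul_le_iff₀ ht]
  nlinarith

theorem inner_hessYY_comm (hf : Assumptions f L₁ L₂ μ) (x : EuclideanSpace ℝ (Fin m))
    (y v w : EuclideanSpace ℝ (Fin n)) :
    inner ℝ (hessYY f x y v) w = inner ℝ (hessYY f x y w) v :=
  inner_fderiv_gradient_comm (hf.contDiff_right x) y v w

/-- Cauchy–Schwarz applied to the negative definiteness of `∇₂₂f`. It yields injectivity, hence
invertibility in finite dimension, and the bound `1/μ` on the inverse. -/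
theorem mul_norm_le_norm_hessYY (hf : Assumptions f L₁ L₂ μ) (x : EuclideanSpace ℝ (Fin m))
    (y v : EuclideanSpace ℝ (Fin n)) : μ * ‖v‖ ≤ ‖hessYY f x y v‖ := by
  rcases eq_or_ne v 0 with rfl | hv
  · simp
  have h1 := hf.inner_hessYY_le x y v
  have h2 := (abs_le.1 (abs_real_inner_le_norm (hessYY f x y v) v)).1
  have hv' : 0 < ‖v‖ := norm_pos_iff.2 hv
  nlinarith

theorem isInvertible_hessYY (hf : Assumptions f L₁ L₂ μ) (hμ : 0 < μ)
    (x : EuclideanSpace ℝ (Fin m)) (y : EuclideanSpace ℝ (Fin n)) :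
    (hessYY f x y).IsInvertible := by
  have hinj : Function.Injective (hessYY f x y).toLinearMap := by
    rw [injective_iff_map_eq_zero]
    intro v hv
    have h := hf.mul_norm_le_norm_hessYY x y v
    rw [ContinuousLinearMap.coe_coe] at hv
    rw [hv, norm_zero] at h
    exact norm_le_zero_iff.1 (nonpos_of_mul_nonpos_right h hμ)
  exact ⟨(LinearEquiv.ofInjectiveEndo _ hinj).toContinuousLinearEquiv, by ext v; rfl⟩

theorem norm_inverse_hessYY_le (hf : Assumptions f L₁ L₂ μ) (hμ : 0 < μ)
    (x : EuclideanSpace ℝ (Fin m)) (y : EuclideanSpace ℝ (Fin n)) :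
    ‖(hessYY f x y).inverse‖ ≤ 1 / μ := by
  refine ContinuousLinearMap.opNorm_le_bound _ (by positivity) fun v => ?_
  have h := hf.mul_norm_le_norm_hessYY x y ((hessYY f x y).inverse v)
  rw [(hf.isInvertible_hessYY hμ x y).self_apply_inverse] at h
  rw [one_div, inv_mul_eq_div, le_div_iff₀ hμ]
  linarith

/-! ### The maximizer map and the derivatives of the envelope. -/

theorem isMaxOn_yStar (hf : Assumptions f L₁ L₂ μ) (hμ : 0 < μ) (x : EuclideanSpace ℝ (Fin m)) :
    IsMaxOn (f x) Set.univ (yStar f x) :=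
  Classical.epsilon_spec (strongConcaveOn_exists_isMaxOn hμ (hf.strongConcave x)
    ((hf.contDiff_right x).differentiable two_ne_zero))

theorem gradY_yStar (hf : Assumptions f L₁ L₂ μ) (hμ : 0 < μ) (x : EuclideanSpace ℝ (Fin m)) :
    gradY f x (yStar f x) = 0 := by
  have h : IsLocalMax (f x) (yStar f x) := (hf.isMaxOn_yStar hμ x).isLocalMax Filter.univ_mem
  rw [gradY, gradient_eq]
  simp [h.fderiv_eq_zero]

theorem envelope_eq (hf : Assumptions f L₁ L₂ μ) (hμ : 0 < μ) (x : EuclideanSpace ℝ (Fin m)) :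
    envelope f x = f x (yStar f x) := by
  have h : IsGreatest (Set.range (f x)) (f x (yStar f x)) :=
    ⟨⟨_, rfl⟩, by rintro _ ⟨y, rfl⟩; exact hf.isMaxOn_yStar hμ x (Set.mem_univ y)⟩
  exact h.csSup_eq

/-- Strong monotonicity of `∇₂f(x, ·)` between the two maximizers bounds `μ` times their distance by
`‖∇₂f(x, y*(x'))‖`, which is at most `L₁‖x - x'‖` because `∇₂f(x', y*(x')) = 0`. -/
theorem norm_yStar_sub_le (hf : Assumptions f L₁ L₂ μ) (hμ : 0 < μ)
    (x x' : EuclideanSpace ℝ (Fin m)) :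
    ‖yStar f x - yStar f x'‖ ≤ L₁ / μ * ‖x - x'‖ := by
  rcases eq_or_ne (yStar f x - yStar f x') 0 with h0 | h0
  -- Used only to see that `L₁ * ‖x - x'‖` is nonnegative.
  · have h1 := hf.norm_gradY_sub_le_left x x' 0
    rw [h0, norm_zero, div_mul_eq_mul_div]
    exact div_nonneg ((norm_nonneg _).trans h1) hμ.le
  have hpos := norm_pos_iff.2 h0
  have h1 := hf.inner_gradY_sub_le x (yStar f x) (yStar f x')
  have h2 := hf.norm_gradY_sub_le_left x x' (yStar f x')
  rw [hf.gradY_yStar hμ x, zero_sub, inner_neg_left] at h1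
  rw [hf.gradY_yStar hμ x', sub_zero] at h2
  have h3 := real_inner_le_norm (gradY f x (yStar f x')) (yStar f x - yStar f x')
  rw [div_mul_eq_mul_div, le_div_iff₀ hμ]
  have h4 : ‖gradY f x (yStar f x')‖ * ‖yStar f x - yStar f x'‖
      ≤ (L₁ * ‖x - x'‖) * ‖yStar f x - yStar f x'‖ := by gcongr
  nlinarith

/-- `∇₂f` vanishes along the graph of `y*`. As `y*` is already Lipschitz, linearizing `∇₂f` at `(x,
y*(x))` leaves an error `o(x' - x)`, and applying `(∇₂₂f)⁻¹` isolates the increment of `y*`. -/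
theorem hasFDerivAt_yStar (hf : Assumptions f L₁ L₂ μ) (hμ : 0 < μ)
    (x : EuclideanSpace ℝ (Fin m)) :
    HasFDerivAt (yStar f)
      (-((hessYY f x (yStar f x)).inverse.comp (hessYX f x (yStar f x)))) x := by
  have hlip : (fun x' => yStar f x' - yStar f x) =O[𝓝 x] fun x' => x' - x :=
    Asymptotics.IsBigO.of_bound _ (Eventually.of_forall fun x' => hf.norm_yStar_sub_le hμ x' x)
  have hcont : Tendsto (fun x' => (x', yStar f x')) (𝓝 x) (𝓝 (x, yStar f x)) := by
    refine tendsto_id.prodMk_nhds ?_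
    rw [← tendsto_sub_nhds_zero_iff]
    exact hlip.trans_tendsto (by simpa using (tendsto_id (x := 𝓝 x)).sub_const x)
  have h1 := (hf.hasFDerivAt_gradY x (yStar f x)).isLittleO.comp_tendsto hcont
  have h2 := h1.trans_isBigO ((Asymptotics.isBigO_refl (fun x' => x' - x) (𝓝 x)).prod_left hlip)
  have h3 := ((hessYY f x (yStar f x)).inverse.isBigO_comp _ (𝓝 x)).trans_isLittleO h2
  refine .of_isLittleO (h3.neg_left.congr_left fun x' => ?_)
  have hinv := hf.isInvertible_hessYY hμ x (yStar f x)
  simp [hf.gradY_yStar hμ, hinv.inverse_apply_self]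
  abel

theorem hasFDerivAt_gradX_yStar (hf : Assumptions f L₁ L₂ μ) (hμ : 0 < μ)
    (x : EuclideanSpace ℝ (Fin m)) :
    HasFDerivAt (fun x' => gradX f x' (yStar f x')) (schurG f x (yStar f x)) x := by
  refine (hasFDerivAt_comp_graph (hf.hasFDerivAt_gradX x (yStar f x))
    (hf.hasFDerivAt_yStar hμ x)).congr_fderiv ?_
  ext1 v
  simp [schurG, sub_eq_add_neg]

/-- Danskin's formula: in the chain rule along the graph of `y*`, the term through `y*` drops out
because the `y`-derivative vanishes at the maximizer. -/
theorem hasFDerivAt_envelope (hf : Assumptions f L₁ L₂ μ) (hμ : 0 < μ)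
    (x : EuclideanSpace ℝ (Fin m)) :
    HasFDerivAt (envelope f) (innerSL ℝ (gradX f x (yStar f x))) x := by
  have h := hasFDerivAt_comp_graph (hasFDerivAt_coprod_partial
    (hf.contDiff.differentiable two_ne_zero (x, yStar f x))) (hf.hasFDerivAt_yStar hμ x)
  have h0 : fderiv ℝ (f x) (yStar f x) = 0 :=
    ((hf.isMaxOn_yStar hμ x).isLocalMax Filter.univ_mem).fderiv_eq_zero
  rw [funext (hf.envelope_eq hμ)]
  refine h.congr_fderiv ?_
  ext1 v
  simp [gradX, h0]

theorem norm_schurG_sub_le (hf : Assumptions f L₁ L₂ μ) (hL₁ : 0 < L₁) (hL₂ : 0 < L₂) (hμ : 0 < μ)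
    (x x' : EuclideanSpace ℝ (Fin m)) (y y' : EuclideanSpace ℝ (Fin n)) :
    ‖schurG f x y - schurG f x' y'‖ ≤ constLG L₁ L₂ μ * pairDist x x' y y' := by
  set d := pairDist x x' y y' with hd
  have hd0 : 0 ≤ d := Real.sqrt_nonneg _
  set A := hessXY f x y
  set A' := hessXY f x' y'
  set B := hessYY f x y with hB
  set B' := hessYY f x' y' with hB'
  set C := hessYX f x y
  set C' := hessYX f x' y'
  have hBi : ∀ v, B (B.inverse v) = v := fun v =>
    (hf.isInvertible_hessYY hμ x y).self_apply_inverse v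
  have hBi' : ∀ v, B'.inverse (B' v) = v := fun v =>
    (hf.isInvertible_hessYY hμ x' y').inverse_apply_self v
  -- Telescoping of `AB⁻¹C - A'B'⁻¹C'`, with `B⁻¹ - B'⁻¹ = -B'⁻¹(B - B')B⁻¹`. The four terms
  -- contribute `1`, `κ`, `κ²` and `κ`, which sum to `(1 + κ)²`.
  have key : schurG f x y - schurG f x' y'
      = (hessXX f x y - hessXX f x' y') - (A - A').comp (B.inverse.comp C)
        + A'.comp (B'.inverse.comp ((B - B').comp (B.inverse.comp C)))
        - A'.comp (B'.inverse.comp (C - C')) := by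
    ext1 v
    simp only [schurG, sub_apply, add_apply,
      ContinuousLinearMap.comp_apply, map_sub, ← hB, ← hB', hBi, hBi']
    abel
  have nA : ‖A'‖ ≤ L₁ := hf.norm_hessXY_le hL₁ _ _
  have nC : ‖C‖ ≤ L₁ := hf.norm_hessYX_le hL₁ _ _
  have nB : ‖B.inverse‖ ≤ 1 / μ := hf.norm_inverse_hessYY_le hμ _ _
  have nB' : ‖B'.inverse‖ ≤ 1 / μ := hf.norm_inverse_hessYY_le hμ _ _
  have dX : ‖hessXX f x y - hessXX f x' y'‖ ≤ L₂ * d := hf.lipXX _ _ _ _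
  have dA : ‖A - A'‖ ≤ L₂ * d := hf.lipXY _ _ _ _
  have dB : ‖B - B'‖ ≤ L₂ * d := hf.lipYY _ _ _ _
  have dC : ‖C - C'‖ ≤ L₂ * d := hf.lipYX _ _ _ _
  have nBC : ‖B.inverse.comp C‖ ≤ 1 / μ * L₁ :=
    (ContinuousLinearMap.opNorm_comp_le _ _).trans (by gcongr)
  have b1 : ‖(A - A').comp (B.inverse.comp C)‖ ≤ (L₂ * d) * (1 / μ * L₁) :=
    (ContinuousLinearMap.opNorm_comp_le _ _).trans (by gcongr)
  have b2 : ‖A'.comp (B'.inverse.comp ((B - B').comp (B.inverse.comp C)))‖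
      ≤ L₁ * (1 / μ * ((L₂ * d) * (1 / μ * L₁))) := by
    refine (ContinuousLinearMap.opNorm_comp_le _ _).trans ?_
    gcongr
    refine (ContinuousLinearMap.opNorm_comp_le _ _).trans ?_
    gcongr
    exact (ContinuousLinearMap.opNorm_comp_le _ _).trans (by gcongr)
  have b3 : ‖A'.comp (B'.inverse.comp (C - C'))‖ ≤ L₁ * (1 / μ * (L₂ * d)) := by
    refine (ContinuousLinearMap.opNorm_comp_le _ _).trans ?_
    gcongr
    exact (ContinuousLinearMap.opNorm_comp_le _ _).trans (by gcongr)
  rw [key]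
  calc _ ≤ L₂ * d + (L₂ * d) * (1 / μ * L₁) + L₁ * (1 / μ * ((L₂ * d) * (1 / μ * L₁)))
          + L₁ * (1 / μ * (L₂ * d)) := by
        refine (norm_sub_le _ _).trans (add_le_add ?_ b3)
        refine (norm_add_le _ _).trans (add_le_add ?_ b2)
        exact (norm_sub_le _ _).trans (add_le_add dX b1)
    _ = constLG L₁ L₂ μ * d := by rw [constLG]; ring

/-- Lipschitz continuity of the Hessian of `Φ`. The additional factor `1 + κ` in `L_Φ` bounds the
stretch of the graph map `x ↦ (x, y*(x))`. -/
theorem norm_schurG_yStar_sub_le (hf : Assumptions f L₁ L₂ μ) (hL₁ : 0 < L₁) (hL₂ : 0 < L₂)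
    (hμ : 0 < μ) (x x' : EuclideanSpace ℝ (Fin m)) :
    ‖schurG f x (yStar f x) - schurG f x' (yStar f x')‖ ≤ constLPhi L₁ L₂ μ * ‖x - x'‖ := by
  refine (hf.norm_schurG_sub_le hL₁ hL₂ hμ _ _ _ _).trans ?_
  have h1 := hf.norm_yStar_sub_le hμ x x'
  have hκ : 0 < L₁ / μ := by positivity
  have h2 : pairDist x x' (yStar f x) (yStar f x') ≤ (1 + L₁ / μ) * ‖x - x'‖ := by
    rw [pairDist]
    refine Real.sqrt_le_iff.2 ⟨by positivity, ?_⟩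
    have h3 : ‖yStar f x - yStar f x'‖ ^ 2 ≤ (L₁ / μ * ‖x - x'‖) ^ 2 := by gcongr
    have h4 : 0 ≤ L₁ / μ * ‖x - x'‖ ^ 2 := by positivity
    nlinarith
  calc _ ≤ constLG L₁ L₂ μ * ((1 + L₁ / μ) * ‖x - x'‖) := by
        have : 0 ≤ constLG L₁ L₂ μ := by rw [constLG]; positivity
        gcongr
    _ = _ := by rw [constLG, constLPhi]; ring

theorem envelope_add_le (hf : Assumptions f L₁ L₂ μ) (hL₁ : 0 < L₁) (hL₂ : 0 < L₂)
    (hμ : 0 < μ) (x s : EuclideanSpace ℝ (Fin m)) :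
    envelope f (x + s) ≤ envelope f x + inner ℝ (gradX f x (yStar f x)) s
      + inner ℝ s (schurG f x (yStar f x) s) / 2 + constLPhi L₁ L₂ μ * ‖s‖ ^ 3 / 6 := by
  have hline : ∀ t : ℝ, HasDerivAt (fun t : ℝ => x + t • s) s t := fun t => by
    simpa using ((hasDerivAt_id t).smul_const s).const_add x
  have h1 : ∀ t : ℝ, HasDerivAt (fun t : ℝ => envelope f (x + t • s))
      (inner ℝ (gradX f (x + t • s) (yStar f (x + t • s))) s) t := fun t => by
    simpa [Function.comp_def] using
      (hf.hasFDerivAt_envelope hμ (x + t • s)).comp_hasDerivAt t (hline t)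
  have h2 : ∀ t : ℝ, HasDerivAt
      (fun t : ℝ => inner ℝ (gradX f (x + t • s) (yStar f (x + t • s))) s)
      (inner ℝ s (schurG f (x + t • s) (yStar f (x + t • s)) s)) t := fun t => by
    have := ((hf.hasFDerivAt_gradX_yStar hμ (x + t • s)).comp_hasDerivAt t (hline t)).inner ℝ
      (hasDerivAt_const t s)
    simpa [real_inner_comm] using this
  have h := taylor_second_order_le h1 h2 (K := constLPhi L₁ L₂ μ * ‖s‖ ^ 3) fun t ht => by
    have hb := hf.norm_schurG_yStar_sub_le hL₁ hL₂ hμ (x + t • s) (x + (0 : ℝ) • s)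
    set G := schurG f (x + t • s) (yStar f (x + t • s))
    set G₀ := schurG f (x + (0 : ℝ) • s) (yStar f (x + (0 : ℝ) • s))
    rw [zero_smul, add_zero, add_sub_cancel_left, norm_smul, Real.norm_of_nonneg ht] at hb
    have h3 : inner ℝ s (G s) - inner ℝ s (G₀ s) = inner ℝ s ((G - G₀) s) := by
      rw [sub_apply, inner_sub_right]
    have h4 := (real_inner_le_norm s ((G - G₀) s)).trans
      (mul_le_mul_of_nonneg_left ((G - G₀).le_of_opNorm_le hb s) (norm_nonneg s))
    nlinarith
  simp only [one_smul, zero_smul, add_zero] at h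
  linarith

/-! ### Contraction of the inner gradient ascent. -/

/-- One gradient ascent step with `ηy = 2 / (L₁ + μ)` contracts the distance to the maximizer. -/
theorem norm_ascentStep_sub_le (hf : Assumptions f L₁ L₂ μ) (hL₁ : 0 < L₁) (hμ : 0 < μ)
    (x : EuclideanSpace ℝ (Fin m)) (y : EuclideanSpace ℝ (Fin n)) :
    ‖ascentStep f (2 / (L₁ + μ)) x y - yStar f x‖
      ≤ Real.exp (-(μ / L₁)) * ‖y - yStar f x‖ := by
  -- The inequality `μ ≤ L₁` needs a nonzero vector, so `n = 0` is treated apart.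
  rcases subsingleton_or_nontrivial (EuclideanSpace ℝ (Fin n)) with hs | hs
  · rw [Subsingleton.elim (ascentStep f (2 / (L₁ + μ)) x y - yStar f x) 0, norm_zero]
    positivity
  have hμL : μ ≤ L₁ := by
    obtain ⟨v, hv⟩ := exists_ne (0 : EuclideanSpace ℝ (Fin n))
    have h1 := hf.mul_norm_le_norm_hessYY x 0 v
    have h2 := (hessYY f x 0).le_of_opNorm_le (hf.norm_hessYY_le hL₁ x 0) v
    exact le_of_mul_le_mul_right (h1.trans h2) (norm_pos_iff.2 hv)
  have hder : ∀ z, HasFDerivAt (ascentStep f (2 / (L₁ + μ)) x)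
      (ContinuousLinearMap.id ℝ _ + (2 / (L₁ + μ)) • hessYY f x z) z := fun z =>
    (hasFDerivAt_id z).fun_add ((hf.hasFDerivAt_gradY_right x z).fun_const_smul _)
  have hρ : 0 ≤ (L₁ - μ) / (L₁ + μ) := div_nonneg (by linarith) (by linarith)
  -- The form of `∇₂₂f` lies between `-L₁‖v‖²` and `-μ‖v‖²`; the step size `2/(L₁ + μ)` sends these
  -- ends to `∓(L₁ - μ)/(L₁ + μ)`.
  have hnorm : ∀ z, ‖ContinuousLinearMap.id ℝ _ + (2 / (L₁ + μ)) • hessYY f x z‖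
      ≤ (L₁ - μ) / (L₁ + μ) := fun z => by
    refine opNorm_le_of_symmetric_of_quadratic hρ (fun v w => ?_) fun v => ?_
    · simp only [add_apply, smul_apply,
        ContinuousLinearMap.id_apply, inner_add_left, inner_smul_left, conj_trivial]
      rw [hf.inner_hessYY_comm x z v w, real_inner_comm]
    · have h1 := hf.inner_hessYY_le x z v
      have h2 := (abs_le.1 (abs_real_inner_le_norm (hessYY f x z v) v)).1
      have h3 := mul_le_mul_of_nonneg_right
        ((hessYY f x z).le_of_opNorm_le (hf.norm_hessYY_le hL₁ x z) v) (norm_nonneg v)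
      simp only [add_apply, smul_apply,
        ContinuousLinearMap.id_apply, inner_add_left, inner_smul_left, conj_trivial,
        real_inner_self_eq_norm_sq]
      set q := inner ℝ (hessYY f x z v) v
      have hLμ : 0 < L₁ + μ := by linarith
      have he : ‖v‖ ^ 2 + 2 / (L₁ + μ) * q = ((L₁ + μ) * ‖v‖ ^ 2 + 2 * q) / (L₁ + μ) := by
        field_simp
      rw [he, abs_div, abs_of_pos hLμ, div_mul_eq_mul_div]
      gcongr
      rw [abs_le]
      constructor <;> nlinarith
  have hfix : ascentStep f (2 / (L₁ + μ)) x (yStar f x) = yStar f x := by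
    simp [ascentStep, hf.gradY_yStar hμ]
  have h := convex_univ.norm_image_sub_le_of_norm_hasFDerivWithin_le
    (fun z _ => (hder z).hasFDerivWithinAt) (fun z _ => hnorm z)
    (Set.mem_univ (yStar f x)) (Set.mem_univ y)
  rw [hfix] at h
  refine h.trans (mul_le_mul_of_nonneg_right ?_ (norm_nonneg _))
  refine le_trans ?_ (Real.add_one_le_exp _)
  rw [div_le_iff₀ (by linarith)]
  have h5 : (-(μ / L₁) + 1) * (L₁ + μ) = L₁ - μ * (μ / L₁) := by field_simp; ring
  rw [h5]
  have h6 : μ / L₁ ≤ 1 := (div_le_one hL₁).2 hμL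
  nlinarith

theorem norm_iterate_ascentStep_sub_le (hf : Assumptions f L₁ L₂ μ) (hL₁ : 0 < L₁) (hμ : 0 < μ)
    (x : EuclideanSpace ℝ (Fin m)) (y : EuclideanSpace ℝ (Fin n)) (N : ℕ) :
    ‖(ascentStep f (2 / (L₁ + μ)) x)^[N] y - yStar f x‖
      ≤ Real.exp (-(μ / L₁) * N) * ‖y - yStar f x‖ := by
  induction N with
  | zero => simp
  | succ N ih =>
    rw [Function.iterate_succ_apply']
    refine (hf.norm_ascentStep_sub_le hL₁ hμ x _).trans ?_
    refine (mul_le_mul_of_nonneg_left ih (Real.exp_pos _).le).trans_eq ?_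
    rw [← mul_assoc, ← Real.exp_add]
    push_cast
    ring_nf

/-- Enough ascent steps bring an initial error of at most `R` below `δ`. -/
theorem norm_iterate_ascentStep_sub_le_of_log_le (hf : Assumptions f L₁ L₂ μ) (hL₁ : 0 < L₁)
    (hμ : 0 < μ) (x : EuclideanSpace ℝ (Fin m)) (y : EuclideanSpace ℝ (Fin n)) {N : ℕ} {R δ : ℝ}
    (hR : 0 < R) (hδ : 0 < δ) (hy : ‖y - yStar f x‖ ≤ R)
    (hN : L₁ / μ * Real.log (R / δ) ≤ N) :
    ‖(ascentStep f (2 / (L₁ + μ)) x)^[N] y - yStar f x‖ ≤ δ := by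
  refine (hf.norm_iterate_ascentStep_sub_le hL₁ hμ x y N).trans ?_
  have h1 : Real.log (R / δ) ≤ μ / L₁ * N := by
    rw [div_mul_eq_mul_div, div_le_iff₀ hμ] at hN
    rw [div_mul_eq_mul_div, le_div_iff₀ hL₁]
    linarith
  have h2 : Real.exp (-(μ / L₁) * N) ≤ δ / R := by
    rw [← Real.exp_log (show 0 < δ / R by positivity), Real.exp_le_exp, ← inv_div R δ,
      Real.log_inv]
    linarith
  calc _ ≤ δ / R * R := by gcongr
    _ = δ := by field_simp

end Assumptions

/-! ### One outer iteration: envelope decrease and inner-loop errors. -/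

variable {m n : ℕ} {f : EuclideanSpace ℝ (Fin m) → EuclideanSpace ℝ (Fin n) → ℝ} {L₁ L₂ μ : ℝ}

/-- Decrease of the envelope along one inexact cubic-regularized step. -/
theorem Assumptions.envelope_cubic_step_le (hf : Assumptions f L₁ L₂ μ) (hL₁ : 0 < L₁)
    (hL₂ : 0 < L₂) (hμ : 0 < μ) {ηx : ℝ} {x s : EuclideanSpace ℝ (Fin m)}
    {y : EuclideanSpace ℝ (Fin n)} (hs : IsMinOn (cubicModel f ηx x y) Set.univ s) :
    envelope f (x + s) ≤ envelope f x - ηx⁻¹ / 4 * ‖s‖ ^ 3 + constLPhi L₁ L₂ μ / 6 * ‖s‖ ^ 3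
      + L₁ * ‖y - yStar f x‖ * ‖s‖ + constLG L₁ L₂ μ * ‖y - yStar f x‖ / 2 * ‖s‖ ^ 2 := by
  have h1 := hf.envelope_add_le hL₁ hL₂ hμ x s
  have h2 := cubic_min_value_le (c := 1 / (6 * ηx)) hs
  have h3 := (real_inner_le_norm (gradX f x (yStar f x) - gradX f x y) s).trans
    (mul_le_mul_of_nonneg_right (hf.norm_gradX_sub_le x _ _) (norm_nonneg s))
  have h4 := hf.norm_schurG_sub_le hL₁ hL₂ hμ x x (yStar f x) y
  have hd : pairDist x x (yStar f x) y = ‖y - yStar f x‖ := by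
    simp [pairDist, norm_sub_rev]
  rw [hd] at h4
  have h5 := (real_inner_le_norm s ((schurG f x (yStar f x) - schurG f x y) s)).trans
    (mul_le_mul_of_nonneg_left (ContinuousLinearMap.le_of_opNorm_le _ h4 s) (norm_nonneg s))
  rw [inner_sub_left, norm_sub_rev _ y] at h3
  rw [sub_apply, inner_sub_right] at h5
  have h6 : 1 / (6 * ηx) = ηx⁻¹ / 6 := by ring
  rw [h6] at h2
  nlinarith

theorem lt_max_incr_of_lt_stopTime {ε' : ℝ} {s : ℕ → EuclideanSpace ℝ (Fin m)} {t : ℕ}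
    (ht : 1 ≤ t) (h : (t : ℕ∞) < stopTime ε' s) :
    ε' < max (incr ε' s (t - 1)) (incr ε' s t) := by
  by_contra! hle
  have hT : stopTime ε' s ≤ t := sInf_le ⟨t, rfl, ht, hle⟩
  exact hT.not_gt h

theorem incr_nonneg {ε' : ℝ} (hε' : 0 ≤ ε') (s : ℕ → EuclideanSpace ℝ (Fin m)) (t : ℕ) :
    0 ≤ incr ε' s t := by
  cases t with
  | zero => exact hε'
  | succ t => exact norm_nonneg _

/-- The error of the first inner loop. -/
theorem IsRun.norm_inner_error_zero_le (hf : Assumptions f L₁ L₂ μ) (hL₁ : 0 < L₁) (hμ : 0 < μ)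
    {β ε' ηx : ℝ} (hβ : 0 < β) (hε' : 0 < ε') {N : ℕ → ℕ} {T : ℕ}
    {x : ℕ → EuclideanSpace ℝ (Fin m)} {y : ℕ → EuclideanSpace ℝ (Fin n)}
    {s : ℕ → EuclideanSpace ℝ (Fin m)} (hrun : IsRun f ηx (2 / (L₁ + μ)) N T x y s) (hT : 0 < T)
    (hN : L₁ / μ * Real.log (L₁ * ‖y 0 - yStar f (x 0)‖ / (2 * β * ε' ^ 2)) ≤ N 0) :
    ‖y 1 - yStar f (x 0)‖ ≤ 2 * β * ε' ^ 2 / L₁ := by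
  have hy : y 1 = _ := hrun.ascent 0 hT
  rw [hy]
  -- If `y 0` is already the maximizer, `hN` says nothing since `Real.log 0 = 0`; the ascent then
  -- stays at its fixed point.
  rcases (norm_nonneg (y 0 - yStar f (x 0))).eq_or_lt' with h0 | h0
  · refine (hf.norm_iterate_ascentStep_sub_le hL₁ hμ _ _ _).trans ?_
    rw [h0, mul_zero]
    positivity
  · refine hf.norm_iterate_ascentStep_sub_le_of_log_le hL₁ hμ _ _ h0 (by positivity) le_rfl ?_
    rwa [div_div_eq_mul_div, mul_comm _ L₁]

/-- The error of the inner loops before termination, given that of the preceding one. -/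
theorem IsRun.norm_inner_error_succ_le (hf : Assumptions f L₁ L₂ μ) (hL₁ : 0 < L₁) (hL₂ : 0 < L₂)
    (hμ : 0 < μ) {α β ε' ηx : ℝ} (hα : 0 < α) (hβ : 0 < β) (hε' : 0 < ε') {N : ℕ → ℕ} {T : ℕ}
    {x : ℕ → EuclideanSpace ℝ (Fin m)} {y : ℕ → EuclideanSpace ℝ (Fin n)}
    {s : ℕ → EuclideanSpace ℝ (Fin m)} (hrun : IsRun f ηx (2 / (L₁ + μ)) N T x y s) {t : ℕ}
    (ht : t + 1 < T)
    (hN : L₁ / μ * Real.log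
        ((2 * L₁ * α * incr ε' s t
            + L₁ * (α + constLG L₁ L₂ μ * (L₁ / μ)) * incr ε' s (t + 1))
          / (constLG L₁ L₂ μ * β * ε' ^ 2)) ≤ N (t + 1))
    (hmax : ε' < max (incr ε' s t) (incr ε' s (t + 1)))
    (hprev : constLG L₁ L₂ μ * ‖y (t + 1) - yStar f (x t)‖
      ≤ α * (2 * incr ε' s t + incr ε' s (t + 1))) :
    ‖y (t + 2) - yStar f (x (t + 1))‖ ≤ β * ε' ^ 2 / L₁ := by
  have hy : y (t + 2) = _ := hrun.ascent (t + 1) ht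
  rw [hy]
  have hLG : 0 < constLG L₁ L₂ μ := by rw [constLG]; positivity
  have ha := incr_nonneg hε'.le s t
  have hb := incr_nonneg hε'.le s (t + 1)
  have hκ : 0 < L₁ / μ := by positivity
  have hab : 0 < incr ε' s t + incr ε' s (t + 1) := by
    have := max_le_add_of_nonneg ha hb
    linarith
  have hR : 0 < 2 * α * incr ε' s t
      + (α + constLG L₁ L₂ μ * (L₁ / μ)) * incr ε' s (t + 1) := by
    have h1 : 0 < α * (incr ε' s t + incr ε' s (t + 1)) := by positivity
    have h2 : 0 ≤ α * incr ε' s t := by positivity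
    have h3 : 0 ≤ constLG L₁ L₂ μ * (L₁ / μ) * incr ε' s (t + 1) := by positivity
    linarith
  -- `R` is the warm-start error: the previous error from `hprev`, plus the drift `κ‖s_{t+1}‖` of
  -- the maximizer. With target `βε'²/L₁`, the quotient is the argument of the logarithm in `hN`.
  refine hf.norm_iterate_ascentStep_sub_le_of_log_le hL₁ hμ _ _
    (R := (2 * α * incr ε' s t + (α + constLG L₁ L₂ μ * (L₁ / μ)) * incr ε' s (t + 1))
      / constLG L₁ L₂ μ) (by positivity) (by positivity) ?_ ?_
  · rw [le_div_iff₀ hLG]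
    have hx : x t - x (t + 1) = -s (t + 1) := by
      rw [hrun.update t (by omega)]
      abel
    have h1 := hf.norm_yStar_sub_le hμ (x t) (x (t + 1))
    rw [hx, norm_neg] at h1
    have h2 := norm_sub_le_norm_sub_add_norm_sub (y (t + 1)) (yStar f (x t)) (yStar f (x (t + 1)))
    have h3 : incr ε' s (t + 1) = ‖s (t + 1)‖ := rfl
    rw [← h3] at h1
    have h4 := mul_le_mul_of_nonneg_right (h2.trans (add_le_add_right h1 _)) hLG.le
    linarith
  · convert hN using 3
    field_simp

end CubicGDA

end

/-! ### Decrease of the potential. -/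

theorem proposition3 {m n : ℕ}
    (f : EuclideanSpace ℝ (Fin m) → EuclideanSpace ℝ (Fin n) → ℝ) (L₁ L₂ μ : ℝ)
    (hL₁ : 0 < L₁) (hL₂ : 0 < L₂) (hμ : 0 < μ) (hf : CubicGDA.Assumptions f L₁ L₂ μ)
    (α β : ℝ) (hα : 0 < α) (hβ : 0 < β)
    (ε' : ℝ) (hε' : 0 < ε') (hε'_le : ε' ≤ α * L₁ / (β * CubicGDA.constLG L₁ L₂ μ))
    (ηx : ℝ) (hηx : 0 < ηx)
    (hηx_le : ηx ≤ (9 * CubicGDA.constLPhi L₁ L₂ μ + 18 * α + 28 * β)⁻¹)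
    (ηy : ℝ) (hηy : ηy = 2 / (L₁ + μ))
    (N : ℕ → ℕ) (T : ℕ)
    (x : ℕ → EuclideanSpace ℝ (Fin m)) (y : ℕ → EuclideanSpace ℝ (Fin n))
    (s : ℕ → EuclideanSpace ℝ (Fin m))
    (hrun : CubicGDA.IsRun f ηx ηy N T x y s)
    (hN_zero : L₁ / μ * Real.log (L₁ * ‖y 0 - CubicGDA.yStar f (x 0)‖ / (2 * β * ε' ^ 2)) ≤ N 0)
    (hN : ∀ t : ℕ, 1 ≤ t → t < T → (t : ℕ∞) < CubicGDA.stopTime ε' s →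
      L₁ / μ * Real.log
        ((2 * L₁ * α * CubicGDA.incr ε' s (t - 1)
            + L₁ * (α + CubicGDA.constLG L₁ L₂ μ * (L₁ / μ)) * CubicGDA.incr ε' s t)
          / (CubicGDA.constLG L₁ L₂ μ * β * ε' ^ 2)) ≤ N t) :
    ∀ t : ℕ, t < T → (t = 0 ∨ ((t + 1 : ℕ) : ℕ∞) < CubicGDA.stopTime ε' s) →
      CubicGDA.potential f L₁ L₂ μ α β ε' x s (t + 1) - CubicGDA.potential f L₁ L₂ μ α β ε' x s t
        ≤ -(CubicGDA.constLPhi L₁ L₂ μ + α + β)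
            * (CubicGDA.incr ε' s (t + 1) ^ 3 + CubicGDA.incr ε' s t ^ 3) := by
  open CubicGDA in
  subst hηy
  have hLG : 0 < constLG L₁ L₂ μ := by rw [constLG]; positivity
  have hLΦ : 0 < constLPhi L₁ L₂ μ := by rw [constLPhi]; positivity
  have hs0 := incr_nonneg hε'.le s
  -- The upper bound on `ε'` serves here: it makes the accuracy required for gradients sufficient
  -- for the matrices `G` too.
  have hscale : constLG L₁ L₂ μ * (β * ε' ^ 2 / L₁) ≤ α * ε' := by
    rw [le_div_iff₀ (by positivity)] at hε'_le
    rw [mul_div_assoc', div_le_iff₀ hL₁]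
    nlinarith
  -- Errors of the inner loops, relative to the neighbouring increments.
  have hzero : 0 < T → ‖y 1 - yStar f (x 0)‖ ≤ 2 * β * ε' ^ 2 / L₁ := fun hT =>
    hrun.norm_inner_error_zero_le hf hL₁ hμ hβ hε' hT hN_zero
  have hzeroG : 0 < T → constLG L₁ L₂ μ * ‖y 1 - yStar f (x 0)‖ ≤ α * (2 * ε') := fun hT => by
    calc _ ≤ constLG L₁ L₂ μ * (2 * β * ε' ^ 2 / L₁) := by gcongr; exact hzero hT
      _ = 2 * (constLG L₁ L₂ μ * (β * ε' ^ 2 / L₁)) := by ring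
      _ ≤ α * (2 * ε') := by linarith
  have hε'_le_add : ∀ t : ℕ, ((t + 1 : ℕ) : ℕ∞) < stopTime ε' s →
      ε' ≤ incr ε' s t + incr ε' s (t + 1) := fun t h =>
    (lt_max_incr_of_lt_stopTime (Nat.le_add_left 1 t) h).le.trans
      (max_le_add_of_nonneg (hs0 t) (hs0 (t + 1)))
  have hsucc : ∀ t : ℕ, t + 1 < T → ((t + 1 : ℕ) : ℕ∞) < stopTime ε' s →
      ‖y (t + 2) - yStar f (x (t + 1))‖ ≤ β * ε' ^ 2 / L₁ := by
    intro t
    induction t with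
    | zero =>
      intro hT ht_lt
      refine hrun.norm_inner_error_succ_le hf hL₁ hL₂ hμ hα hβ hε' hT
        (hN 1 le_rfl hT ht_lt) (lt_max_incr_of_lt_stopTime le_rfl ht_lt) ?_
      refine (hzeroG (by omega)).trans ?_
      have h0 : incr ε' s 0 = ε' := rfl
      rw [h0]
      gcongr
      linarith [hs0 1]
    | succ t ih =>
      intro hT ht_lt
      refine hrun.norm_inner_error_succ_le hf hL₁ hL₂ hμ hα hβ hε' hT
        (hN (t + 2) (by omega) hT ht_lt) (lt_max_incr_of_lt_stopTime (by omega) ht_lt) ?_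
      have hprev := ih (by omega) (lt_of_le_of_lt (by exact_mod_cast Nat.le_succ _) ht_lt)
      calc _ ≤ constLG L₁ L₂ μ * (β * ε' ^ 2 / L₁) := by gcongr
        _ ≤ α * ε' := hscale
        _ ≤ _ := by
          gcongr
          linarith [hε'_le_add (t + 1) ht_lt, hs0 (t + 1)]
  intro t hT ht
  have herr : L₁ * ‖y (t + 1) - yStar f (x t)‖
        ≤ β * (2 * incr ε' s t ^ 2 + incr ε' s (t + 1) ^ 2) ∧
      constLG L₁ L₂ μ * ‖y (t + 1) - yStar f (x t)‖
        ≤ α * (2 * incr ε' s t + incr ε' s (t + 1)) := by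
    -- At `t = 0` the convention `‖s_0‖ = ε'` makes the error bound `2βε'²/L₁` already relative, so
    -- no stopping condition is needed.
    rcases t with _ | t
    · have h0 : incr ε' s 0 = ε' := rfl
      rw [h0]
      have h1 := hzero hT
      rw [le_div_iff₀ hL₁] at h1
      have h2 : 0 ≤ β * incr ε' s (0 + 1) ^ 2 := by positivity
      have h3 : 0 ≤ α * incr ε' s (0 + 1) := mul_nonneg hα.le (hs0 _)
      have h4 := hzeroG hT
      constructor
      · linarith
      · linarith
    · have ht_lt := ht.resolve_left (Nat.succ_ne_zero t)
      have h1 := hsucc t hT (lt_of_le_of_lt (by exact_mod_cast Nat.le_succ _) ht_lt)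
      -- The error bound itself needs only the preceding index to be before termination; comparing
      -- `ε'` with this pair of increments needs the next one.
      have h2 := lt_max_incr_of_lt_stopTime (by omega) ht_lt
      have h3 : ε' ^ 2 ≤ 2 * incr ε' s (t + 1) ^ 2 + incr ε' s (t + 1 + 1) ^ 2 := by
        rcases lt_max_iff.1 h2 with h | h
        · have : ε' ^ 2 ≤ incr ε' s (t + 1) ^ 2 := pow_le_pow_left₀ hε'.le h.le 2
          nlinarith [sq_nonneg (incr ε' s (t + 1 + 1))]
        · have : ε' ^ 2 ≤ incr ε' s (t + 1 + 1) ^ 2 := pow_le_pow_left₀ hε'.le h.le 2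
          nlinarith [sq_nonneg (incr ε' s (t + 1))]
      constructor
      · rw [le_div_iff₀ hL₁] at h1
        have h4 := mul_le_mul_of_nonneg_left h3 hβ.le
        linarith
      · calc _ ≤ constLG L₁ L₂ μ * (β * ε' ^ 2 / L₁) := by gcongr
          _ ≤ α * ε' := hscale
          _ ≤ _ := by
            gcongr
            linarith [hε'_le_add (t + 1) ht_lt, hs0 (t + 1)]
  have hdesc := hf.envelope_cubic_step_le hL₁ hL₂ hμ (hrun.cubic t hT)
  rw [← hrun.update t hT] at hdesc
  have hη : 9 * constLPhi L₁ L₂ μ + 18 * α + 28 * β ≤ ηx⁻¹ :=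
    (le_inv_comm₀ hηx (by positivity)).1 hηx_le
  have hb_eq : ‖s (t + 1)‖ = incr ε' s (t + 1) := rfl
  rw [hb_eq] at hdesc
  have ha := hs0 t
  have hb := hs0 (t + 1)
  rw [potential, potential]
  set a := incr ε' s t
  set b := incr ε' s (t + 1)
  set LΦ := constLPhi L₁ L₂ μ
  have e1 := mul_le_mul_of_nonneg_right herr.1 hb
  have e2 := mul_le_mul_of_nonneg_right herr.2 (sq_nonneg b)
  have e3 := mul_le_mul_of_nonneg_right hη (pow_nonneg hb 3)
  -- The differences factor as `(2a + b)(a - b)²` here and `(a + 2b)(a - b)²` in `e5`.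
  have e4 : 3 * (a ^ 2 * b) ≤ 2 * a ^ 3 + b ^ 3 := by
    nlinarith [mul_nonneg (by positivity : 0 ≤ 2 * a + b) (sq_nonneg (a - b))]
  have e5 : 3 * (a * b ^ 2) ≤ a ^ 3 + 2 * b ^ 3 := by
    nlinarith [mul_nonneg (by positivity : 0 ≤ a + 2 * b) (sq_nonneg (a - b))]
  have e6 := mul_le_mul_of_nonneg_left e4 hβ.le
  have e7 := mul_le_mul_of_nonneg_left e5 hα.le
  have p1 := mul_nonneg hLΦ.le (pow_nonneg hb 3)
  have p2 := mul_nonneg hα.le (pow_nonneg hb 3)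
  have p3 := mul_nonneg hβ.le (pow_nonneg hb 3)
  have p4 := mul_nonneg hα.le (pow_nonneg ha 3)
  have p5 := mul_nonneg hβ.le (pow_nonneg ha 3)
  -- The coefficients of `b³` sum to at most `-(13/12)LΦ - (4/3)α - (7/3)β`, those of `a³` to `-LΦ -
  -- (5/3)α - (5/3)β`; both are at most `-(LΦ + α + β)`.
  linarith
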